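/- Throughout, Hilbert spaces are complex, and $B(\mathcal M)^g$ is the set of $g$-tuples of bounded operators on the Hilbert space $\mathcal M$; sums, compressions $V^*XV$ and adjoints of tuples are taken entrywise. For $n\ge 1$ let $\mathcal H_n$ be the $n$-dimensional Hilbert space. A tuple $X\in B(\mathcal M)^g$ is *irreducible* if $\mathcal M\neq\{0\}$ and the only closed subspaces $W\subseteq\mathcal M$ such that $W$ and $W^\perp$ are both invariant under every $X_j$ are $\{0\}$ and $\mathcal M$. For a $g$-tuple $X$ of bounded self-adjoint operators on $\mathcal M$, the *noncommutative convex hull* of $X$ is $K_X=(K_X(n))_{n\ge1}$, where $K_X(n)$ is the set of $g$-tuples $Y$ of self-adjoint operators on $\mathcal H_n$ such that $Y=V^*(I\otimes X)V$ for some isometry $V:\mathcal H_n\to\bigoplus_{1}^{\infty}\mathcal M$; here $I\otimes X$ acts as $X$ in each summand. The *noncommutative hull polygon* with *corners* $X^1,\dots,X^k$, where each $X^i$ is an irreducible $g$-tuple of bounded self-adjoint operators on a Hilbert space $\mathcal M_i$, is $K=K_{X^1\oplus\cdots\oplus X^k}$. We say that $0$ is in the *finite interior* of $K$ if $0\in\mathbb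 R^g$ is a finite matrix convex combination of corners, that is, if there are $d\in\mathbb N$, indices $c_1,\dots,c_d\in\{1,\dots,k\}$ and operators $V_l:\mathcal H_1\to\mathcal M_{c_l}$ with $\sum_{l=1}^d V_l^*V_l=I$ and $\sum_{l=1}^d V_l^*X^{c_l}V_l=0$. A tuple $Y\in K(n)$ is an *absolute extreme point* of $K$ if, whenever $Y=\sum_{l=1}^d V_l^*Z^lV_l$ with $Z^l\in K(m_l)$, $0\neq V_l\in B(\mathcal H_n,\mathcal H_{m_l})$ and $\sum_{l=1}^d V_l^*V_l=I_n$, then for every $l$ either $m_l=n$ and $Y$ is unitarily equivalent to $Z^l$, or $m_l>n$ and there is $A\in K$ such that $Y\oplus A$ is unitarily equivalent to $Z^l$. **Corollary.** Let $K$ be a noncommutative hull polygon whose corners $X^1,\dots,X^k$ are irreducible $g$-tuples of compact self-adjoint operators, each acting on a separable infinite-dimensional Hilbert space, and assume that $0$ is in the finite interior of $K$. Then $K$ has no absolute extreme points, i.e. no $Y\in K(n)$, for any $n\ge1$, is an absolute extreme point of $K$. -/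

import Mathlib

open scoped InnerProductSpace

noncomputable section

namespace MatConv

/-- A `g`-tuple of bounded operators on the complex Hilbert space `M`. -/
abbrev OpTuple (g : ℕ) (M : Type*) [NormedAddCommGroup M] [InnerProductSpace ℂ M] :=
  Fin g → M →L[ℂ] M

/-- The `n`-dimensional Hilbert space, for positive `n`. -/
abbrev Hn (n : ℕ+) : Type := EuclideanSpace ℂ (Fin (n : ℕ))

/-- A graded set `(Γ(n))_{n ≥ 1}`, where `Γ(n)` is a set of `g`-tuples of operators on the
`n`-dimensional Hilbert space. -/
abbrev GradedSet (g : ℕ) := (n : ℕ+) → Set (OpTuple g (Hn n))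

section Operators

variable {g : ℕ}

/-- The closed subspace `W` reduces the tuple `X`: both `W` and its orthogonal complement are
invariant under every `X j`. -/
structure IsReducing {M : Type*} [NormedAddCommGroup M] [InnerProductSpace ℂ M]
    (X : OpTuple g M) (W : Submodule ℂ M) : Prop where
  isClosed : IsClosed (W : Set M)
  map_mem : ∀ j, ∀ x ∈ W, X j x ∈ W
  map_mem_orthogonal : ∀ j, ∀ x ∈ Wᗮ, X j x ∈ Wᗮ

/-- `X` is irreducible: its only reducing subspaces are `0` and the whole (nonzero) space. -/
def IsIrreducible {M : Type*} [NormedAddCommGroup M] [InnerProductSpace ℂ M]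
    (X : OpTuple g M) : Prop :=
  Nontrivial M ∧ ∀ W : Submodule ℂ M, IsReducing X W → W = ⊥ ∨ W = ⊤

/-- Unitary equivalence of tuples. The unitary may go between two different spaces. -/
def UnitarilyEquivalent {M N : Type*} [NormedAddCommGroup M] [InnerProductSpace ℂ M]
    [NormedAddCommGroup N] [InnerProductSpace ℂ N] (Y : OpTuple g M) (Z : OpTuple g N) : Prop :=
  ∃ U : M ≃ₗᵢ[ℂ] N, ∀ j, ∀ x : M, U (Y j x) = Z j (U x)

/-- The direct sum `Y ⊕ A` of two tuples, on the Hilbert space direct sum. -/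
def directSum {M N : Type*} [NormedAddCommGroup M] [InnerProductSpace ℂ M]
    [NormedAddCommGroup N] [InnerProductSpace ℂ N] (Y : OpTuple g M) (A : OpTuple g N) :
    OpTuple g (WithLp 2 (M × N)) := fun j =>
  ((WithLp.prodContinuousLinearEquiv 2 ℂ M N).symm : M × N →L[ℂ] WithLp 2 (M × N)) ∘L
    ((Y j).prodMap (A j)) ∘L
      (WithLp.prodContinuousLinearEquiv 2 ℂ M N : WithLp 2 (M × N) →L[ℂ] M × N)

/-- The direct sum `X¹ ⊕ ⋯ ⊕ Xᵏ` of finitely many tuples, on the Hilbert space direct sum. -/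
def finDirectSum {k : ℕ} {H : Fin k → Type*} [∀ i, NormedAddCommGroup (H i)]
    [∀ i, InnerProductSpace ℂ (H i)] (X : ∀ i, OpTuple g (H i)) : OpTuple g (PiLp 2 H) := fun j =>
  ((PiLp.continuousLinearEquiv 2 ℂ H).symm : (∀ i, H i) →L[ℂ] PiLp 2 H) ∘L
    (ContinuousLinearMap.piMap fun i => X i j) ∘L
      (PiLp.continuousLinearEquiv 2 ℂ H : PiLp 2 H →L[ℂ] ∀ i, H i)

/-- The tuple `I ⊗ X` acting diagonally on the Hilbert space sum of countably many copies
of `M`. -/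
def ampliation {M : Type*} [NormedAddCommGroup M] [InnerProductSpace ℂ M] (X : OpTuple g M) :
    OpTuple g (lp (fun _ : ℕ => M) 2) := fun j =>
  lp.mapCLM 2 (fun _ : ℕ => X j) (norm_nonneg (X j)) (fun _ => le_refl _)

/-- `Y = ∑ₗ Vₗ* Zˡ Vₗ` with `∑ₗ Vₗ* Vₗ = I`: the tuple `Y` is the matrix convex combination of
the tuples `Zˡ` with coefficients `Vₗ`. -/
structure IsMatrixConvexCombination {E : Type*} [NormedAddCommGroup E] [InnerProductSpace ℂ E]
    [CompleteSpace E] {d : ℕ} {M : Fin d → Type*} [∀ l, NormedAddCommGroup (M l)]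
    [∀ l, InnerProductSpace ℂ (M l)] [∀ l, CompleteSpace (M l)]
    (Y : OpTuple g E) (Z : ∀ l, OpTuple g (M l)) (V : ∀ l, E →L[ℂ] M l) : Prop where
  sum_eq_one : ∑ l, (V l).adjoint ∘L V l = ContinuousLinearMap.id ℂ E
  eq_sum : ∀ j, Y j = ∑ l, (V l).adjoint ∘L Z l j ∘L V l

end Operators

section Hulls

variable {g : ℕ}

/-- The noncommutative convex hull `K_X`: its level `n` consists of the self-adjoint tuples
`Y = V* (I ⊗ X) V`, where `V` is an isometry from the `n`-dimensional Hilbert space into the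
sum of countably many copies of `M`. -/
def ncConvexHull {M : Type*} [NormedAddCommGroup M] [InnerProductSpace ℂ M] [CompleteSpace M]
    (X : OpTuple g M) : GradedSet g := fun n =>
  {Y | (∀ j, IsSelfAdjoint (Y j)) ∧
    ∃ V : Hn n →ₗᵢ[ℂ] lp (fun _ : ℕ => M) 2, ∀ j,
      Y j = V.toContinuousLinearMap.adjoint ∘L ampliation X j ∘L V.toContinuousLinearMap}

/-- The noncommutative convex hull of a finite family of tuples, i.e. of their direct sum. When
the tuples are irreducible and self-adjoint, this is the noncommutative hull polygon with these
corners. -/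
def ncHullPolygon {k : ℕ} {H : Fin k → Type*} [∀ i, NormedAddCommGroup (H i)]
    [∀ i, InnerProductSpace ℂ (H i)] [∀ i, CompleteSpace (H i)] (X : ∀ i, OpTuple g (H i)) :
    GradedSet g :=
  ncConvexHull (finDirectSum X)

/-- `0` is in the finite interior of the hull polygon with corners `Xⁱ`: the zero tuple at
level one is a finite matrix convex combination of corners (repetitions are allowed). -/
def ZeroMemFiniteInterior {k : ℕ} {H : Fin k → Type*} [∀ i, NormedAddCommGroup (H i)]
    [∀ i, InnerProductSpace ℂ (H i)] [∀ i, CompleteSpace (H i)] (X : ∀ i, OpTuple g (H i)) :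
    Prop :=
  ∃ (d : ℕ) (c : Fin d → Fin k) (V : ∀ l, Hn 1 →L[ℂ] H (c l)),
    IsMatrixConvexCombination (0 : OpTuple g (Hn 1)) (fun l => X (c l)) V

/-- `Y ∈ K(n)` is an absolute extreme point of `K`: in every weakly proper (all coefficients are
nonzero) matrix convex combination `Y = ∑ₗ Vₗ* Zˡ Vₗ` of elements `Zˡ ∈ K(m l)`, each `Zˡ` either
has the size of `Y` and is unitarily equivalent to `Y`, or is larger and unitarily equivalent to
`Y ⊕ A` for some `A ∈ K`. -/
def IsAbsoluteExtremePoint (K : GradedSet g) {n : ℕ+} (Y : OpTuple g (Hn n)) : Prop :=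
  Y ∈ K n ∧
    ∀ (d : ℕ) (m : Fin d → ℕ+) (Z : ∀ l, OpTuple g (Hn (m l))) (V : ∀ l, Hn n →L[ℂ] Hn (m l)),
      (∀ l, Z l ∈ K (m l)) → (∀ l, V l ≠ 0) → IsMatrixConvexCombination Y Z V →
        ∀ l, (m l = n ∧ UnitarilyEquivalent Y (Z l)) ∨
          (n < m l ∧ ∃ (r : ℕ+) (A : OpTuple g (Hn r)),
            A ∈ K r ∧ UnitarilyEquivalent (directSum Y A) (Z l))

/-- The graded set of absolute extreme points of `K`. -/
def absoluteExtremePoints (K : GradedSet g) : GradedSet g := fun n =>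
  {Y : OpTuple g (Hn n) | IsAbsoluteExtremePoint K Y}

end Hulls

end MatConv

end

open scoped InnerProductSpace

namespace MatConv

/-! ### Traces of a tuple entry and of its square. -/

section Traces

variable {E F : Type*} [NormedAddCommGroup E] [InnerProductSpace ℂ E]
  [NormedAddCommGroup F] [InnerProductSpace ℂ F]

/-! Suppose `Y = V* (I ⊗ X) V` is an absolute extreme point. For a unit vector `x` orthogonal to the
range of `V`, compressing `I ⊗ X` to `ran V ⊕ ℂx` gives a point of the hull one size larger that
dilates `Y`, so it is unitarily equivalent to `Y ⊕ a` with `a` of size one. This equivalence need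
not respect the given copy of `Y`, but the traces of each entry and of its square are unitary
invariants, and they force the off-diagonal block to vanish (`offDiagonal_eq_zero`). Hence `ran V`
is invariant under `I ⊗ X` (`ampliation_mem_range_of_isAbsoluteExtremePoint`). Each coordinate
projection to a corner's space carries `ran V` to a finite-dimensional invariant subspace of an
irreducible self-adjoint tuple on an infinite-dimensional space, which is zero. So `V = 0`,
impossible for an isometry on a nonzero space. -/

theorem trace_sq_eq_sum_inner {ι : Type*} [Fintype ι] [DecidableEq ι]
    (b : OrthonormalBasis ι ℂ E) (S : E →ₗ[ℂ] E) :
    LinearMap.trace ℂ E (S ∘ₗ S) = ∑ i, ∑ j, ⟪b i, S (b j)⟫_ℂ * ⟪b j, S (b i)⟫_ℂ := by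
  rw [LinearMap.trace_eq_matrix_trace ℂ b.toBasis, LinearMap.toMatrix_comp _ b.toBasis]
  simp [Matrix.trace, Matrix.mul_apply, LinearMap.toMatrix_apply, OrthonormalBasis.repr_apply_apply]

/-- Applied to the size-one summand `A`: both of its traces are determined by a single scalar. -/
theorem trace_sq_eq_sq_trace_of_finrank_eq_one (h : Module.finrank ℂ E = 1) (S : E →ₗ[ℂ] E) :
    LinearMap.trace ℂ E (S ∘ₗ S) = LinearMap.trace ℂ E S ^ 2 := by
  have : FiniteDimensional ℂ E := Module.finite_of_finrank_eq_succ h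
  let b := (stdOrthonormalBasis ℂ E).reindex (finCongr h)
  rw [trace_sq_eq_sum_inner b, LinearMap.trace_eq_sum_inner S b]
  simp [sq]

theorem trace_eq_of_unitarilyEquivalent {S : E →L[ℂ] E} {S' : F →L[ℂ] F} (U : E ≃ₗᵢ[ℂ] F)
    (h : ∀ x, U (S x) = S' (U x)) :
    LinearMap.trace ℂ F S' = LinearMap.trace ℂ E S ∧
      LinearMap.trace ℂ F (S'.toLinearMap ∘ₗ S'.toLinearMap) =
        LinearMap.trace ℂ E (S.toLinearMap ∘ₗ S.toLinearMap) := by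
  constructor
  · rw [← LinearMap.trace_conj' S.toLinearMap U.toLinearEquiv]
    congr 1
    ext x
    simp [LinearEquiv.conj_apply, h]
  · rw [← LinearMap.trace_conj' (S.toLinearMap ∘ₗ S.toLinearMap) U.toLinearEquiv]
    congr 1
    ext x
    simp [LinearEquiv.conj_apply, h]

theorem trace_directSum [FiniteDimensional ℂ E] [FiniteDimensional ℂ F] {g : ℕ}
    (Y : OpTuple g E) (A : OpTuple g F) (j : Fin g) :
    LinearMap.trace ℂ _ (directSum Y A j).toLinearMap =
        LinearMap.trace ℂ E (Y j) + LinearMap.trace ℂ F (A j) ∧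
      LinearMap.trace ℂ _ ((directSum Y A j).toLinearMap ∘ₗ (directSum Y A j).toLinearMap) =
        LinearMap.trace ℂ E ((Y j).toLinearMap ∘ₗ (Y j).toLinearMap) +
          LinearMap.trace ℂ F ((A j).toLinearMap ∘ₗ (A j).toLinearMap) := by
  constructor
  · rw [← LinearMap.trace_prodMap', ← LinearMap.trace_conj' _
      (WithLp.linearEquiv 2 ℂ (E × F)).symm]
    rfl
  · rw [← LinearMap.trace_prodMap', ← LinearMap.trace_conj' _
      (WithLp.linearEquiv 2 ℂ (E × F)).symm]
    rfl

/-- A self-adjoint operator on `ℂⁿ⁺¹` whose trace and squared trace are those of the direct sum of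
its upper left corner with a scalar is block diagonal. -/
theorem offDiagonal_eq_zero {n : ℕ} {S : Fin (n + 1) → Fin (n + 1) → ℂ} {a : ℂ}
    (hS : ∀ i j, S j i = star (S i j))
    (h₁ : ∑ i, S i i = ∑ i : Fin n, S i.castSucc i.castSucc + a)
    (h₂ : ∑ i, ∑ j, S i j * S j i =
      ∑ i : Fin n, ∑ j : Fin n, S i.castSucc j.castSucc * S j.castSucc i.castSucc + a ^ 2)
    (i : Fin n) : S (Fin.last n) i.castSucc = 0 := by
  simp only [Fin.sum_univ_castSucc, Finset.sum_add_distrib] at h₁ h₂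
  -- The first trace fixes the last diagonal entry, so in the squared trace only the off-diagonal
  -- terms survive.
  have ha : S (Fin.last n) (Fin.last n) = a := add_left_cancel h₁
  rw [ha] at h₂
  have h₃ : ∑ i : Fin n, ((‖S (Fin.last n) i.castSucc‖ ^ 2 : ℝ) : ℂ) = 0 := by
    have e : ∀ i : Fin n, ((‖S (Fin.last n) i.castSucc‖ ^ 2 : ℝ) : ℂ) =
        S (Fin.last n) i.castSucc * S i.castSucc (Fin.last n) := by
      intro i
      rw [hS (Fin.last n) i.castSucc]
      simpa using (Complex.mul_conj' _).symm
    have e' : ∑ i : Fin n, S i.castSucc (Fin.last n) * S (Fin.last n) i.castSucc =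
        ∑ i : Fin n, S (Fin.last n) i.castSucc * S i.castSucc (Fin.last n) :=
      Finset.sum_congr rfl fun _ _ => mul_comm _ _
    simp only [e]
    rw [e'] at h₂
    -- Each off-diagonal entry is counted twice, once from the last row and once from the last
    -- column.
    linear_combination h₂ / 2
  rw [← Complex.ofReal_sum, Complex.ofReal_eq_zero,
    Finset.sum_eq_zero_iff_of_nonneg fun _ _ => by positivity] at h₃
  simpa using h₃ i (Finset.mem_univ i)

end Traces

/-! ### Compressions of `I ⊗ X` and invariant subspaces. -/

section Compression

variable {g : ℕ}

theorem exists_linearIsometry_of_orthonormal {ι E F : Type*} [Fintype ι]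
    [NormedAddCommGroup E] [InnerProductSpace ℂ E] [NormedAddCommGroup F] [InnerProductSpace ℂ F]
    (b : OrthonormalBasis ι ℂ E) {w : ι → F} (hw : Orthonormal ℂ w) :
    ∃ W : E →ₗᵢ[ℂ] F, ∀ i, W (b i) = w i := by
  have h : ∀ i, b.toBasis.constr ℂ w (b i) = w i := fun i => by
    simpa only [b.coe_toBasis] using b.toBasis.constr_basis ℂ w i
  refine ⟨(b.toBasis.constr ℂ w).isometryOfOrthonormal (v := b.toBasis)
    (by simpa only [b.coe_toBasis] using b.orthonormal) ?_, h⟩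
  rwa [b.coe_toBasis, show b.toBasis.constr ℂ w ∘ b = w from funext h]

theorem ampliation_inner {M : Type*} [NormedAddCommGroup M] [InnerProductSpace ℂ M]
    [CompleteSpace M] {X : OpTuple g M} (hX : ∀ j, IsSelfAdjoint (X j)) (j : Fin g)
    (x y : lp (fun _ : ℕ => M) 2) :
    ⟪ampliation X j x, y⟫_ℂ = ⟪x, ampliation X j y⟫_ℂ := by
  rw [lp.inner_eq_tsum, lp.inner_eq_tsum]
  exact tsum_congr fun p => (hX j).isSymmetric (x p) (y p)

theorem isSelfAdjoint_finDirectSum {k : ℕ} {H : Fin k → Type*} [∀ i, NormedAddCommGroup (H i)]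
    [∀ i, InnerProductSpace ℂ (H i)] [∀ i, CompleteSpace (H i)] {X : ∀ i, OpTuple g (H i)}
    (hX : ∀ i j, IsSelfAdjoint (X i j)) (j : Fin g) : IsSelfAdjoint (finDirectSum X j) := by
  rw [ContinuousLinearMap.isSelfAdjoint_iff_isSymmetric]
  intro x y
  simp only [PiLp.inner_apply]
  exact Finset.sum_congr rfl fun i _ => (hX i j).isSymmetric (x i) (y i)

/-- If the compression of `I ⊗ X` to the range of `V` is an absolute extreme point of the hull of
`X`, then the range of `V` is invariant under `I ⊗ X`. -/
theorem ampliation_mem_range_of_isAbsoluteExtremePoint {M : Type*} [NormedAddCommGroup M]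
    [InnerProductSpace ℂ M] [CompleteSpace M] {X : OpTuple g M} (hX : ∀ j, IsSelfAdjoint (X j))
    {n : ℕ+} {Y : OpTuple g (Hn n)} (hY : IsAbsoluteExtremePoint (ncConvexHull X) Y)
    (V : Hn n →ₗᵢ[ℂ] lp (fun _ : ℕ => M) 2)
    (hV : ∀ j, Y j =
      V.toContinuousLinearMap.adjoint ∘L ampliation X j ∘L V.toContinuousLinearMap)
    (j : Fin g) (u : Hn n) :
    ampliation X j (V u) ∈ LinearMap.range V.toLinearMap := by
  set R := LinearMap.range V.toLinearMap with hR
  let b := EuclideanSpace.basisFun (Fin n) ℂ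
  have hVb : Orthonormal ℂ (V ∘ b) := b.orthonormal.comp_linearIsometry V
  -- The off-diagonal entries of every one-dimensional enlargement of the compression vanish.
  have key : ∀ x ∈ Rᗮ, ‖x‖ = 1 → ∀ i, ⟪x, ampliation X j (V (b i))⟫_ℂ = 0 := by
    intro x hx hx1 i
    have hxV : ∀ u, ⟪V u, x⟫_ℂ = 0 := fun u =>
      (Submodule.mem_orthogonal R x).1 hx _ ⟨u, rfl⟩
    let m : ℕ+ := ⟨n + 1, Nat.succ_pos _⟩
    let c : OrthonormalBasis (Fin (n + 1)) ℂ (Hn m) := EuclideanSpace.basisFun (Fin (n + 1)) ℂ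
    let w : Fin (n + 1) → lp (fun _ : ℕ => M) 2 := Fin.snoc (fun i => V (b i)) x
    have hw : Orthonormal ℂ w := by
      rw [orthonormal_iff_ite] at hVb ⊢
      intro p q
      induction p using Fin.lastCases with
      | last =>
        induction q using Fin.lastCases with
        | last => simp [w, hx1]
        | cast q =>
          have : ⟪x, V (b q)⟫_ℂ = 0 := inner_eq_zero_symm.1 (hxV _)
          simp [w, this, (Fin.castSucc_lt_last q).ne']
      | cast p =>
        induction q using Fin.lastCases with
        | last => simp [w, hxV, (Fin.castSucc_lt_last p).ne]
        | cast q => simpa [w] using hVb p q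
    obtain ⟨W, hWc⟩ := exists_linearIsometry_of_orthonormal c hw
    -- `J` embeds the first `n` coordinates, so `V = W J` and `Y = J* Z J` is a one-term matrix
    -- convex combination.
    obtain ⟨J, hJb⟩ := exists_linearIsometry_of_orthonormal b
      (c.orthonormal.comp _ (Fin.castSucc_injective (n : ℕ)))
    have hWJ : ∀ u, W (J u) = V u := by
      have : W.toLinearMap ∘ₗ J.toLinearMap = V.toLinearMap := by
        refine b.toBasis.ext fun i => ?_
        simp [hJb, hWc, w]
      exact fun u => LinearMap.congr_fun this u
    let Z : OpTuple g (Hn m) := fun j =>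
      W.toContinuousLinearMap.adjoint ∘L ampliation X j ∘L W.toContinuousLinearMap
    have hZin : ∀ j y z, ⟪y, Z j z⟫_ℂ = ⟪W y, ampliation X j (W z)⟫_ℂ := fun j y z => by
      simp [Z, ContinuousLinearMap.adjoint_inner_right]
    have hYin : ∀ j y z, ⟪y, Y j z⟫_ℂ = ⟪V y, ampliation X j (V z)⟫_ℂ := fun j y z => by
      simp [hV, ContinuousLinearMap.adjoint_inner_right]
    have hZsymm : ∀ j y z, ⟪Z j y, z⟫_ℂ = ⟪y, Z j z⟫_ℂ := fun j y z => by
      rw [← inner_conj_symm, hZin, inner_conj_symm, ampliation_inner hX, hZin]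
    have hZ : Z ∈ ncConvexHull X m :=
      ⟨fun j => ContinuousLinearMap.isSelfAdjoint_iff_isSymmetric.2 (hZsymm j), W, fun _ => rfl⟩
    have hcomb : IsMatrixConvexCombination Y (fun _ : Fin 1 => Z)
        (fun _ => J.toContinuousLinearMap) := by
      constructor
      · ext1 u
        refine ext_inner_left ℂ fun y => ?_
        simp
      · intro j
        ext1 u
        refine ext_inner_left ℂ fun y => ?_
        simp [ContinuousLinearMap.adjoint_inner_right, hZin, hYin, hWJ]
    have hJ0 : J.toContinuousLinearMap ≠ 0 := by
      intro h
      have h1 : J (b ⟨0, n.pos⟩) = 0 := DFunLike.congr_fun h _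
      have h2 := J.norm_map (b ⟨0, n.pos⟩)
      rw [h1, b.norm_eq_one, norm_zero] at h2
      exact zero_ne_one h2
    rcases hY.2 1 (fun _ => m) (fun _ => Z) (fun _ => J.toContinuousLinearMap) (fun _ => hZ)
      (fun _ => hJ0) hcomb 0 with ⟨h, -⟩ | ⟨-, r, A, -, U, hU⟩
    · have := congrArg PNat.val h
      simp [m] at this
    -- Counting dimensions in `Y ⊕ A ≅ Z`: `n + r = n + 1`.
    · have hr : Module.finrank ℂ (Hn r) = 1 := by
        have h1 := ((WithLp.linearEquiv 2 ℂ (Hn n × Hn r)).symm.trans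
          U.toLinearEquiv).finrank_eq
        rw [Module.finrank_prod] at h1
        simp only [finrank_euclideanSpace, Fintype.card_fin] at h1 ⊢
        exact Nat.add_left_cancel h1
      obtain ⟨t₁, t₂⟩ := trace_eq_of_unitarilyEquivalent U (hU j)
      obtain ⟨s₁, s₂⟩ := trace_directSum Y A j
      rw [s₁, LinearMap.trace_eq_sum_inner _ c, LinearMap.trace_eq_sum_inner _ b] at t₁
      rw [s₂, trace_sq_eq_sum_inner c, trace_sq_eq_sum_inner b,
        trace_sq_eq_sq_trace_of_finrank_eq_one hr] at t₂
      have := offDiagonal_eq_zero (S := fun p q => ⟪c p, Z j (c q)⟫_ℂ)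
        (fun p q => by
          rw [← hZsymm]
          exact (inner_conj_symm _ _).symm)
        (by simpa [hZin, hYin, hWc, w] using t₁) (by simpa [hZin, hYin, hWc, w] using t₂) i
      simpa [hZin, hWc, w] using this
  have key' : ∀ x ∈ Rᗮ, ⟪x, ampliation X j (V u)⟫_ℂ = 0 := by
    intro x hx
    rcases eq_or_ne x 0 with rfl | hx0
    · simp
    have h1 := key _ (Rᗮ.smul_mem ((‖x‖ : ℂ)⁻¹) hx) (norm_smul_inv_norm hx0)
    have h2 : (innerₛₗ ℂ x) ∘ₗ (ampliation X j).toLinearMap ∘ₗ V.toLinearMap = 0 := by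
      refine b.toBasis.ext fun i => ?_
      have := h1 i
      rw [inner_smul_left] at this
      simpa [hx0] using this
    exact LinearMap.congr_fun h2 u
  -- `R` is finite-dimensional, hence equal to its double orthogonal complement.
  rw [← R.orthogonal_orthogonal, Submodule.mem_orthogonal]
  exact key'

/-- A finite-dimensional invariant subspace of an irreducible self-adjoint tuple on an
infinite-dimensional space is zero. -/
theorem IsIrreducible.eq_bot_of_finiteDimensional {M : Type*} [NormedAddCommGroup M]
    [InnerProductSpace ℂ M] [CompleteSpace M] {X : OpTuple g M} (hirr : IsIrreducible X)
    (hX : ∀ j, IsSelfAdjoint (X j)) (hM : ¬ FiniteDimensional ℂ M) (W : Submodule ℂ M)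
    [FiniteDimensional ℂ W] (hW : ∀ j, ∀ x ∈ W, X j x ∈ W) : W = ⊥ := by
  refine (hirr.2 W ⟨W.closed_of_finiteDimensional, hW, fun j x hx => ?_⟩).resolve_right ?_
  · rw [Submodule.mem_orthogonal] at hx ⊢
    intro u hu
    rw [← hx _ (hW j u hu)]
    exact ((hX j).isSymmetric u x).symm
  · rintro rfl
    exact hM (LinearEquiv.finiteDimensional (Submodule.topEquiv (R := ℂ) (M := M)))

end Compression

end MatConv

theorem corollary1p1 {g k : ℕ} (H : Fin k → Type*) [∀ i, NormedAddCommGroup (H i)]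
    [∀ i, InnerProductSpace ℂ (H i)] [∀ i, CompleteSpace (H i)]
    [∀ i, TopologicalSpace.SeparableSpace (H i)]
    (infinite_dim : ∀ i, ¬ FiniteDimensional ℂ (H i))
    (X : ∀ i, MatConv.OpTuple g (H i))
    (selfAdjoint : ∀ i j, IsSelfAdjoint (X i j))
    (compact : ∀ i j, IsCompactOperator (X i j))
    (irreducible : ∀ i, MatConv.IsIrreducible (X i))
    (zero_mem : MatConv.ZeroMemFiniteInterior X) :
    ∀ n : ℕ+, MatConv.absoluteExtremePoints (MatConv.ncHullPolygon X) n = ∅ := by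
  intro n
  refine Set.eq_empty_iff_forall_notMem.2 fun Y hY => ?_
  have hY : MatConv.IsAbsoluteExtremePoint (MatConv.ncConvexHull (MatConv.finDirectSum X)) Y := hY
  obtain ⟨-, V, hV⟩ := hY.1
  have hinv := MatConv.ampliation_mem_range_of_isAbsoluteExtremePoint
    (MatConv.isSelfAdjoint_finDirectSum selfAdjoint) hY V hV
  have hzero : ∀ u, V u = 0 := by
    intro u
    ext p i
    -- `π` intertwines `I ⊗ X` with the corner `X i`, so it maps the invariant range of `V` to an
    -- invariant subspace.
    let π : lp (fun _ : ℕ => PiLp 2 H) 2 →ₗ[ℂ] H i :=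
      { toFun := fun f => f p i
        map_add' := fun _ _ => rfl
        map_smul' := fun _ _ => rfl }
    have hbot := (irreducible i).eq_bot_of_finiteDimensional (selfAdjoint i) (infinite_dim i)
      ((LinearMap.range V.toLinearMap).map π) (by
        rintro j _ ⟨_, ⟨v, rfl⟩, rfl⟩
        exact ⟨_, hinv j v, rfl⟩)
    have hmem : π (V u) ∈ (LinearMap.range V.toLinearMap).map π := ⟨_, ⟨u, rfl⟩, rfl⟩
    rw [hbot] at hmem
    exact (Submodule.mem_bot ℂ).1 hmem
  let e : MatConv.Hn n := EuclideanSpace.single ⟨0, n.pos⟩ 1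
  have h := V.norm_map e
  simp [hzero, e] at h
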